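/- Let $F$ be a field of prime characteristic $p$ and let $L$ be a Lie algebra over $F$ (of arbitrary dimension). A $p$-mapping on a Lie algebra $G$ over $F$ is a map $G\to G$, $x\mapsto x^{[p]}$, such that for all $a,b\in G$ and $\alpha\in F$: (1) $\operatorname{ad}(a^{[p]})=(\operatorname{ad}a)^p$; (2) $(\alpha a)^{[p]}=\alpha^p a^{[p]}$; (3) $(a+b)^{[p]}=a^{[p]}+b^{[p]}+\sum_{i=1}^{p-1}s_i(a,b)$, where the elements $s_i(a,b)\in G$ are determined by $(\operatorname{ad}(a\otimes X+b\otimes 1))^{p-1}(a\otimes 1)=\sum_{i=1}^{p-1} i\,s_i(a,b)\otimes X^{i-1}$ in $G\otimes_F F[X]$. A $p$-envelope of $L$ is a triple $(G,[p],i)$ consisting of a Lie algebra $G$ over $F$, a $p$-mapping $[p]$ on $G$, and an injective Lie algebra homomorphism $i:L\to G$, such that the only Lie subalgebra of $G$ that contains $i(L)$ and is stable under $[p]$ is $G$ itself. Theorem. Let $(G,[p],i)$ be a $p$-envelope of $L$, let $V$ be a vector space over $F$ (of arbitrary dimension), and let $\rho:L\to\mathfrak{gl}(V)$ be a representation. Then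 there exists a representation $\widehat{\rho}:G\to\mathfrak{gl}(V)$ such that $\widehat{\rho}\circ i=\rho$ and such that every $L$-submodule of $V$ (every subspace stable under $\rho(L)$) is a $G$-submodule (stable under $\widehat{\rho}(G)$). -/

import Mathlib

open scoped TensorProduct

attribute [local instance 100] LieRing.ofAssociativeRing

namespace ModularLie

section PMaps

variable (F : Type*) [Field F] {G : Type*} [LieRing G] [LieAlgebra F G]

/-- The family `s` satisfies the identity
`(ad (a ⊗ X + b ⊗ 1)) ^ (p - 1) (a ⊗ 1) = ∑ i ∈ {1, …, p - 1}, i s i ⊗ X ^ (i - 1)`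
in the base change of `G` to `F[X]` (with the polynomial factor written on the left).
Over a field of characteristic `p` the integers `1, …, p - 1` are invertible, so this
determines `s 1, …, s (p - 1)` uniquely; they are the elements `s_i(a, b)`. -/
def IsJacobsonFamily (p : ℕ) (a b : G) (s : ℕ → G) : Prop :=
  ((LieAlgebra.ad (Polynomial F) (Polynomial F ⊗[F] G)
      ((Polynomial.X : Polynomial F) ⊗ₜ[F] a + (1 : Polynomial F) ⊗ₜ[F] b)) ^ (p - 1))
      ((1 : Polynomial F) ⊗ₜ[F] a) =
    ∑ i ∈ Finset.Icc 1 (p - 1), (Polynomial.X ^ (i - 1) : Polynomial F) ⊗ₜ[F] (i • s i)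

/-- `pm : G → G` is a `p`-mapping, that is, `(G, pm)` is a restricted Lie algebra. -/
structure IsPMapping (p : ℕ) (pm : G → G) : Prop where
  ad_map : ∀ a : G, LieAlgebra.ad F G (pm a) = LieAlgebra.ad F G a ^ p
  map_smul : ∀ (α : F) (a : G), pm (α • a) = α ^ p • pm a
  map_add : ∀ a b : G, ∃ s : ℕ → G, IsJacobsonFamily F p a b s ∧
    pm (a + b) = pm a + pm b + ∑ i ∈ Finset.Icc 1 (p - 1), s i

variable {F}

/-- A Lie subalgebra is a `p`-subalgebra if it is stable under the `p`-mapping. -/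
def IsPSubalgebra (pm : G → G) (H : LieSubalgebra F G) : Prop :=
  ∀ x ∈ H, pm x ∈ H

variable (F) in
/-- The `p`-subalgebra `S_p` generated by `S`: the intersection of all `p`-subalgebras
containing `S`. -/
def pClosure (pm : G → G) (S : Set G) : LieSubalgebra F G :=
  sInf {H : LieSubalgebra F G | IsPSubalgebra pm H ∧ S ⊆ (H : Set G)}

/-- `(G, pm, i)` is a `p`-envelope of `L`. -/
structure IsPEnvelope {L : Type*} [LieRing L] [LieAlgebra F L]
    (p : ℕ) (pm : G → G) (i : L →ₗ⁅F⁆ G) : Prop where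
  isPMapping : IsPMapping F p pm
  injective : Function.Injective i
  generates : pClosure F pm (Set.range i) = ⊤

end PMaps

/-- The subspace `W` of `V` is a submodule for the representation `ρ` of `L` on `V`. -/
def IsSubrepresentation {F L V : Type*} [Field F] [LieRing L] [LieAlgebra F L]
    [AddCommGroup V] [Module F V] (ρ : L →ₗ⁅F⁆ Module.End F V) (W : Submodule F V) : Prop :=
  ∀ (x : L), ∀ v ∈ W, ρ x v ∈ W

end ModularLie

/-! In `G × End V`, consider the span `P` of the pairs `(pm^[k] (i x), ρ x ^ p ^ k)`. Both
components act under `ad` as `p ^ k`-th powers, so the bracket of two such pairs is `(i z, ρ z)`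
with one common `z` in `L` (`exists_lie_of_mem_powerGraph`). Hence the projection of `P` to `G` is a
`p`-subalgebra containing the image of `i`, that is, all of `G`. `P` need not be single-valued over
`G`, but any linear section that extends `ρ` is a homomorphism: brackets in `P` land in the pairs
`(i z, ρ z)`, where the section is prescribed. Its values are combinations of powers of operators `ρ
x`, so they preserve submodules. -/

namespace ModularLie

open LieAlgebra

/-! ### Powers of inner derivations in characteristic `p`. -/

section Associative

variable {F A : Type*} [Field F] [Ring A] [Algebra F A] (p : ℕ) [Fact p.Prime] [CharP F p]

/-- In characteristic `p`, the inner derivation of an associative algebra defined by `a ^ p ^ k`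
is the `p ^ k`-th power of the one defined by `a`. -/
theorem ad_pow_char_pow (a : A) (k : ℕ) : ad F A (a ^ p ^ k) = ad F A a ^ p ^ k := by
  rcases subsingleton_or_nontrivial A with _ | _
  · exact LinearMap.ext fun _ => Subsingleton.elim _ _
  have : CharP (Module.End F A) p :=
    charP_of_injective_algebraMap (algebraMap F (Module.End F A)).injective p
  -- Left and right multiplication by `a` commute, so the power of their difference splits.
  rw [LieAlgebra.ad_eq_lmul_left_sub_lmul_right]
  simp only [Pi.sub_apply]
  rw [sub_pow_char_pow_of_commute _ _ (LinearMap.commute_mulLeft_right a a),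
    LinearMap.pow_mulLeft, LinearMap.pow_mulRight]

end Associative

/-! ### Jacobson's elements and `p`-subalgebras. -/

section Coefficients

variable {F G : Type*} [Field F] [LieRing G] [LieAlgebra F G]

variable (F G) in
/-- The coefficient of `X ^ j` of an element of `G[X] = F[X] ⊗ G`. -/
noncomputable def tensorCoeff (j : ℕ) : Polynomial F ⊗[F] G →ₗ[F] G :=
  (TensorProduct.lid F G).toLinearMap ∘ₗ (Polynomial.lcoeff F j).rTensor G

@[simp]
theorem tensorCoeff_tmul (j : ℕ) (f : Polynomial F) (x : G) :
    tensorCoeff F G j (f ⊗ₜ[F] x) = f.coeff j • x := by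
  simp [tensorCoeff]

/-- Bracketing with `1 ⊗ b` preserves degrees and with `X ⊗ a` raises them by one; this gives a
recursion for the coefficients. -/
theorem tensorCoeff_one_tmul_lie (j : ℕ) (b : G) (t : Polynomial F ⊗[F] G) :
    tensorCoeff F G j (ad (Polynomial F) (Polynomial F ⊗[F] G)
      ((1 : Polynomial F) ⊗ₜ[F] b) t) = ⁅b, tensorCoeff F G j t⁆ := by
  induction t using TensorProduct.induction_on with
  | zero => simp
  | tmul f x => simp [LieAlgebra.ExtendScalars.bracket_tmul]
  | add s t hs ht => simp only [map_add, lie_add, hs, ht]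

theorem tensorCoeff_succ_X_tmul_lie (j : ℕ) (a : G) (t : Polynomial F ⊗[F] G) :
    tensorCoeff F G (j + 1) (ad (Polynomial F) (Polynomial F ⊗[F] G)
      ((Polynomial.X : Polynomial F) ⊗ₜ[F] a) t) =
      ⁅a, tensorCoeff F G j t⁆ := by
  induction t using TensorProduct.induction_on with
  | zero => simp
  | tmul f x => simp [LieAlgebra.ExtendScalars.bracket_tmul]
  | add s t hs ht => simp only [map_add, lie_add, hs, ht]

theorem tensorCoeff_zero_X_tmul_lie (a : G) (t : Polynomial F ⊗[F] G) :
    tensorCoeff F G 0 (ad (Polynomial F) (Polynomial F ⊗[F] G)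
      ((Polynomial.X : Polynomial F) ⊗ₜ[F] a) t) = 0 := by
  induction t using TensorProduct.induction_on with
  | zero => simp
  | tmul f x => simp [LieAlgebra.ExtendScalars.bracket_tmul]
  | add s t hs ht => simp only [map_add, hs, ht, add_zero]

/-- The coefficients of `(ad (a ⊗ X + b ⊗ 1)) ^ n (a ⊗ 1)` lie in every subalgebra containing
`a` and `b`. -/
theorem tensorCoeff_ad_pow_mem (H : LieSubalgebra F G) {a b : G} (ha : a ∈ H) (hb : b ∈ H)
    (n j : ℕ) :
    tensorCoeff F G j (((ad (Polynomial F) (Polynomial F ⊗[F] G)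
      ((Polynomial.X : Polynomial F) ⊗ₜ[F] a + (1 : Polynomial F) ⊗ₜ[F] b)) ^ n)
        ((1 : Polynomial F) ⊗ₜ[F] a)) ∈ H := by
  induction n generalizing j with
  | zero => simpa using H.smul_mem _ ha
  | succ n ih =>
    rw [pow_succ', Module.End.mul_apply]
    generalize ((ad (Polynomial F) (Polynomial F ⊗[F] G)
      ((Polynomial.X : Polynomial F) ⊗ₜ[F] a + (1 : Polynomial F) ⊗ₜ[F] b)) ^ n)
        ((1 : Polynomial F) ⊗ₜ[F] a) = t at ih ⊢
    rw [map_add, LinearMap.add_apply, map_add, tensorCoeff_one_tmul_lie]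
    refine H.add_mem ?_ (H.lie_mem hb (ih j))
    cases j with
    | zero =>
      rw [tensorCoeff_zero_X_tmul_lie]
      exact H.zero_mem
    | succ j =>
      rw [tensorCoeff_succ_X_tmul_lie]
      exact H.lie_mem ha (ih j)

theorem IsPMapping.ad_iterate {p : ℕ} {pm : G → G} (hpm : IsPMapping F p pm) (a : G) (k : ℕ) :
    ad F G (pm^[k] a) = ad F G a ^ p ^ k := by
  induction k with
  | zero => simp
  | succ k ih => rw [Function.iterate_succ_apply', hpm.ad_map, ih, ← pow_mul, pow_succ]

variable {p : ℕ} [Fact p.Prime] [CharP F p]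

/-- The elements `s_i(a, b)` lie in every subalgebra containing `a` and `b`. -/
theorem IsJacobsonFamily.mem {a b : G} {s : ℕ → G} (hs : IsJacobsonFamily F p a b s)
    (H : LieSubalgebra F G) (ha : a ∈ H) (hb : b ∈ H) {m : ℕ} (hm : m ∈ Finset.Icc 1 (p - 1)) :
    s m ∈ H := by
  have hmem := tensorCoeff_ad_pow_mem H ha hb (p - 1) (m - 1)
  -- The coefficient of `X ^ (m - 1)` is `m • s m`, and `m` is invertible in `F`.
  rw [hs, map_sum, Finset.sum_eq_single_of_mem m hm] at hmem
  · obtain ⟨h1, h2⟩ := Finset.mem_Icc.mp hm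
    have hm0 : (m : F) ≠ 0 := by
      rw [Ne, CharP.cast_eq_zero_iff F p]
      exact Nat.not_dvd_of_pos_of_lt h1 (by have := (Fact.out : p.Prime).pos; omega)
    rw [tensorCoeff_tmul, Polynomial.coeff_X_pow_self, one_smul,
      ← Nat.cast_smul_eq_nsmul F] at hmem
    simpa [smul_smul, hm0] using H.smul_mem (m : F)⁻¹ hmem
  · intro k hk hkm
    have h1 := (Finset.mem_Icc.mp hk).1
    have h2 := (Finset.mem_Icc.mp hm).1
    rw [tensorCoeff_tmul, Polynomial.coeff_X_pow, if_neg (by omega), zero_smul]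

/-- A subalgebra spanned by a set that is stable under the `p`-mapping is a `p`-subalgebra. -/
theorem IsPMapping.isPSubalgebra_of_span {pm : G → G} (hpm : IsPMapping F p pm)
    (H : LieSubalgebra F G) {S : Set G} (hH : H.toSubmodule = Submodule.span F S)
    (hS : ∀ x ∈ S, pm x ∈ S) : IsPSubalgebra pm H := by
  intro x hx
  have hx' : x ∈ Submodule.span F S := hH ▸ hx
  have hmem : ∀ y, y ∈ Submodule.span F S → y ∈ H := fun y hy => by
    rwa [← hH] at hy
  induction hx' using Submodule.span_induction with
  | mem y hy => exact hmem _ (Submodule.subset_span (hS y hy))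
  | zero =>
    have h0 := hpm.map_smul 0 0
    rw [zero_smul, zero_pow (Fact.out : p.Prime).ne_zero, zero_smul] at h0
    rw [h0]
    exact H.zero_mem
  | add y z hy hz ihy ihz =>
    obtain ⟨s, hs, hadd⟩ := hpm.map_add y z
    rw [hadd]
    exact H.add_mem (H.add_mem (ihy (hmem y hy)) (ihz (hmem z hz)))
      (sum_mem fun m hm => hs.mem H (hmem y hy) (hmem z hz) hm)
  | smul c y hy ih =>
    rw [hpm.map_smul]
    exact H.smul_mem _ (ih (hmem y hy))

end Coefficients

/-! ### The span of paired powers and the extension of `ρ`. -/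

section Graph

variable {F L G A : Type*} [Field F] [LieRing L] [LieAlgebra F L] [LieRing G] [LieAlgebra F G]
  [Ring A] [Algebra F A] (p : ℕ) (pm : G → G) (i : L →ₗ⁅F⁆ G) (ρ : L →ₗ⁅F⁆ A)

/-- The span in `G × A` of the iterated `p`-th powers of the pairs `(i x, ρ x)`. -/
def powerGraph : Submodule F (G × A) :=
  Submodule.span F {q | ∃ (k : ℕ) (x : L), q = (pm^[k] (i x), ρ x ^ p ^ k)}

theorem mk_mem_powerGraph (x : L) : (i x, ρ x) ∈ powerGraph p pm i ρ :=
  Submodule.subset_span ⟨0, x, by simp⟩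

theorem ad_pow_map_apply {B : Type*} [LieRing B] [LieAlgebra F B] (f : L →ₗ⁅F⁆ B) (x y : L)
    (n : ℕ) : ((ad F B (f x)) ^ n) (f y) = f (((ad F L x) ^ n) y) := by
  induction n with
  | zero => simp
  | succ n ih => simp only [pow_succ', Module.End.mul_apply, ih, ad_apply, LieHom.map_lie]

/-- Since `n` is positive, one factor `ad (f x)` can be applied to `b` first; skew symmetry turns
the result into `-(ad b) (f x)`, and everything is now computed inside the image of `f`. The element
of `L` obtained does not depend on `f`, so `i` and `ρ` share it. -/
theorem lie_eq_of_ad_eq_pow {B : Type*} [LieRing B] [LieAlgebra F B] (f : L →ₗ⁅F⁆ B) {x y : L}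
    {n m l : ℕ} (hn : n = m + 1) (a b : B) (ha : ad F B a = ad F B (f x) ^ n)
    (hb : ad F B b = ad F B (f y) ^ l) :
    ⁅a, b⁆ = f (-((ad F L x ^ m) ((ad F L y ^ l) x))) := by
  rw [← ad_apply F B, ha, hn, pow_succ, Module.End.mul_apply, ad_apply, ← lie_skew,
    ← ad_apply F B, hb, ad_pow_map_apply, map_neg, ad_pow_map_apply, map_neg]

variable {p pm} [Fact p.Prime] [CharP F p]

/-- The iterated `p`-th powers of the elements `i x` and `ρ x` have the same brackets. -/
theorem exists_lie_generators (hpm : IsPMapping F p pm) (k l : ℕ) (x y : L) :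
    ∃ z : L, ⁅pm^[k] (i x), pm^[l] (i y)⁆ = i z ∧ ⁅ρ x ^ p ^ k, ρ y ^ p ^ l⁆ = ρ z := by
  obtain ⟨m, hm⟩ : ∃ m, p ^ k = m + 1 :=
    ⟨p ^ k - 1, (Nat.sub_add_cancel (Nat.pos_of_ne_zero
      (pow_ne_zero k (Fact.out : p.Prime).ne_zero))).symm⟩
  exact ⟨_, lie_eq_of_ad_eq_pow i hm _ _ (hpm.ad_iterate _ _) (hpm.ad_iterate _ _),
    lie_eq_of_ad_eq_pow ρ hm _ _ (ad_pow_char_pow p _ _) (ad_pow_char_pow p _ _)⟩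

/-- Brackets of elements of `powerGraph` lie in the graph `{(i z, ρ z)}`. -/
theorem exists_lie_of_mem_powerGraph (hpm : IsPMapping F p pm) {q r : G × A}
    (hq : q ∈ powerGraph p pm i ρ) (hr : r ∈ powerGraph p pm i ρ) :
    ∃ z : L, ⁅q.1, r.1⁆ = i z ∧ ⁅q.2, r.2⁆ = ρ z := by
  induction hq, hr using Submodule.span_induction₂ with
  | mem_mem q r hq hr =>
    obtain ⟨k, x, rfl⟩ := hq
    obtain ⟨l, y, rfl⟩ := hr
    exact exists_lie_generators i ρ hpm k l x y
  | zero_left => exact ⟨0, by simp⟩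
  | zero_right => exact ⟨0, by simp⟩
  | add_left q q' r _ _ _ h h' =>
    obtain ⟨z, h1, h2⟩ := h
    obtain ⟨z', h1', h2'⟩ := h'
    exact ⟨z + z', by simp [h1, h1'], by simp [h2, h2']⟩
  | add_right q r r' _ _ _ h h' =>
    obtain ⟨z, h1, h2⟩ := h
    obtain ⟨z', h1', h2'⟩ := h'
    exact ⟨z + z', by simp [h1, h1'], by simp [h2, h2']⟩
  | smul_left c q r _ _ h =>
    obtain ⟨z, h1, h2⟩ := h
    exact ⟨c • z, by simp [h1], by simp [h2]⟩
  | smul_right c q r _ _ h =>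
    obtain ⟨z, h1, h2⟩ := h
    exact ⟨c • z, by simp [h1], by simp [h2]⟩

/-- For a `p`-envelope, the projection of `powerGraph` to `G` is surjective. -/
theorem exists_mem_powerGraph (hG : IsPEnvelope p pm i) (g : G) :
    ∃ q ∈ powerGraph p pm i ρ, q.1 = g := by
  let H : LieSubalgebra F G :=
    { (powerGraph p pm i ρ).map (LinearMap.fst F G A) with
      lie_mem' := by
        rintro _ _ ⟨q, hq, rfl⟩ ⟨r, hr, rfl⟩
        obtain ⟨z, hz, -⟩ := exists_lie_of_mem_powerGraph i ρ hG.isPMapping hq hr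
        exact ⟨(i z, ρ z), mk_mem_powerGraph p pm i ρ z, hz.symm⟩ }
  have hH : IsPSubalgebra pm H := by
    refine hG.isPMapping.isPSubalgebra_of_span H (Submodule.map_span _ _) ?_
    rintro _ ⟨_, ⟨k, x, rfl⟩, rfl⟩
    -- Applying `pm` to a generator only raises `k` by one.
    exact ⟨_, ⟨k + 1, x, rfl⟩, Function.iterate_succ_apply' _ _ _⟩
  have hle : pClosure F pm (Set.range i) ≤ H := sInf_le ⟨hH, by
    rintro _ ⟨x, rfl⟩
    exact ⟨(i x, ρ x), mk_mem_powerGraph p pm i ρ x, rfl⟩⟩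
  rw [hG.generates] at hle
  exact hle (LieSubalgebra.mem_top g)

/-- A homomorphism from `L` to an associative algebra extends to every `p`-envelope, with graph
inside `powerGraph`. -/
theorem exists_extension (hG : IsPEnvelope p pm i) :
    ∃ ρ' : G →ₗ⁅F⁆ A, (∀ x, ρ' (i x) = ρ x) ∧ ∀ g, (g, ρ' g) ∈ powerGraph p pm i ρ := by
  let P := powerGraph p pm i ρ
  obtain ⟨σ, hσ⟩ := ((LinearMap.fst F G A).comp P.subtype).exists_rightInverse_of_surjective
    (LinearMap.range_eq_top.mpr fun g =>
      let ⟨q, hq, h⟩ := exists_mem_powerGraph i ρ hG g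
      ⟨⟨q, hq⟩, h⟩)
  obtain ⟨π, hπ⟩ := (i : L →ₗ[F] G).exists_leftInverse_of_injective
    (LinearMap.ker_eq_bot.mpr hG.injective)
  have hσ' (g : G) : (σ g : G × A).1 = g := LinearMap.congr_fun hσ g
  have hπ' (x : L) : π (i x) = x := LinearMap.congr_fun hπ x
  -- Split `g = (g - i (π g)) + i (π g)`: the section `σ` is used on the first summand and `ρ` on
  -- the second, which corrects `σ` on the image of `i`.
  let τ : G →ₗ[F] A := (LinearMap.snd F G A ∘ₗ P.subtype ∘ₗ σ) ∘ₗ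
    (LinearMap.id - (i : L →ₗ[F] G) ∘ₗ π) + (ρ : L →ₗ[F] A) ∘ₗ π
  have hτ (g : G) : τ g = (σ (g - i (π g)) : G × A).2 + ρ (π g) := rfl
  have hτi (x : L) : τ (i x) = ρ x := by simp [hτ, hπ']
  have hτP (g : G) : (g, τ g) ∈ P := by
    have hadd := P.add_mem (σ (g - i (π g))).2 (mk_mem_powerGraph p pm i ρ (π g))
    convert hadd using 1
    exact Prod.ext (by simp [hσ']) (hτ g)
  refine ⟨{ τ with map_lie' := ?_ }, hτi, hτP⟩
  intro g h
  obtain ⟨z, h1, h2⟩ := exists_lie_of_mem_powerGraph i ρ hG.isPMapping (hτP g) (hτP h)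
  change τ ⁅g, h⁆ = ⁅τ g, τ h⁆
  rw [show ⁅g, h⁆ = i z from h1, hτi]
  exact h2.symm

end Graph

/-- The operators occurring in `powerGraph` stabilise every subrepresentation. -/
theorem IsSubrepresentation.snd_apply_mem {F L G V : Type*} [Field F] [LieRing L]
    [LieAlgebra F L] [LieRing G] [LieAlgebra F G] [AddCommGroup V] [Module F V] {p : ℕ}
    {pm : G → G} {i : L →ₗ⁅F⁆ G} {ρ : L →ₗ⁅F⁆ Module.End F V} {W : Submodule F V}
    (hW : IsSubrepresentation ρ W) {q : G × Module.End F V} (hq : q ∈ powerGraph p pm i ρ)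
    {v : V} (hv : v ∈ W) : q.2 v ∈ W := by
  induction hq using Submodule.span_induction with
  | mem q hq =>
    obtain ⟨k, x, rfl⟩ := hq
    exact Module.End.pow_apply_mem_of_forall_mem (p ^ k) (hW x) v hv
  | zero => exact W.zero_mem
  | add q r _ _ h h' => exact W.add_mem h h'
  | smul c q _ h => exact W.smul_mem c h

end ModularLie

theorem mainTheorem11 {F L G V : Type*} [Field F] (p : ℕ) [Fact p.Prime] [CharP F p]
    [LieRing L] [LieAlgebra F L] [LieRing G] [LieAlgebra F G]
    [AddCommGroup V] [Module F V]
    (pm : G → G) (i : L →ₗ⁅F⁆ G) (hG : ModularLie.IsPEnvelope p pm i)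
    (ρ : L →ₗ⁅F⁆ Module.End F V) :
    ∃ ρ' : G →ₗ⁅F⁆ Module.End F V,
      (∀ x : L, ρ' (i x) = ρ x) ∧
      ∀ W : Submodule F V, ModularLie.IsSubrepresentation ρ W →
        ModularLie.IsSubrepresentation ρ' W := by
  obtain ⟨ρ', hi, hmem⟩ := ModularLie.exists_extension i ρ hG
  exact ⟨ρ', hi, fun W hW g v hv => hW.snd_apply_mem (hmem g) hv⟩
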